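/- Let $P$ and $Q$ be simple polygons in the Euclidean plane, and let $\mathrm{Int}(P)$ and $\mathrm{Int}(Q)$ be the open regions bounded by them, i.e. the bounded connected components of the complements of their boundary curves. Assume $\mathrm{Int}(P)\cap \mathrm{Int}(Q)=\emptyset$. Say that $P$ and $Q$ are separated by a circle $\Sigma$ if the open disk interior to $\Sigma$ contains $\mathrm{Int}(P)$ and no point of $\mathrm{Int}(Q)$, or contains $\mathrm{Int}(Q)$ and no point of $\mathrm{Int}(P)$; here $\Sigma$ is a circle of positive radius or a circle of infinite radius, that is, a line, whose interior disk is then one of its two open half-planes. Then $P$ and $Q$ cannot be separated by a circle if and only if there exist a circle $C$ (of finite positive radius) and four distinct points $x_1,x_2,x_3,x_4$, in that cyclic order on $C$, such that $x_1,x_3\in \mathrm{Int}(Q)$ and $x_2,x_4\in \mathrm{Int}(P)$. -/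

import Mathlib

/-- The Euclidean plane. -/
abbrev Plane : Type := EuclideanSpace ℝ (Fin 2)

/-- A polygon is simple if it has at least three vertices and its closed boundary curve does not
touch itself: run through once, edge after edge, each edge with its first endpoint and without its
last one, the curve visits no point twice. -/
def Polygon.IsSimple {n : ℕ} (P : Polygon Plane n) : Prop :=
  3 ≤ n ∧ ∀ i j : Fin n, ∀ s ∈ Set.Ico (0 : ℝ) 1, ∀ t ∈ Set.Ico (0 : ℝ) 1,
    P.edgePath ℝ i s = P.edgePath ℝ j t → i = j ∧ s = t

/-- `U` is the (open) region bounded by the polygon `P`: the bounded connected component of the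
complement of the boundary curve of `P`. By the Jordan curve theorem a simple polygon has exactly
one such region. -/
def Polygon.IsInterior {n : ℕ} (P : Polygon Plane n) (U : Set Plane) : Prop :=
  Bornology.IsBounded U ∧
    ∃ x ∈ (P.boundary ℝ)ᶜ, U = connectedComponentIn (P.boundary ℝ)ᶜ x

/-- `D` is the open disk which is the interior of a circle of positive, possibly infinite radius:
either a genuine open disk or, for a circle of infinite radius (a line), an open half-plane. -/
def IsOpenDisk (D : Set Plane) : Prop :=
  (∃ (c : Plane) (r : ℝ), 0 < r ∧ D = Metric.ball c r) ∨
    ∃ (u : Plane) (b : ℝ), u ≠ 0 ∧ D = {x : Plane | inner ℝ u x < b}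

/-- The sets `A` and `B` are separated by a circle, possibly of infinite radius: its open interior
disk contains one of the two sets and no point of the other. -/
def CircularlySeparable (A B : Set Plane) : Prop :=
  ∃ D : Set Plane, IsOpenDisk D ∧ ((A ⊆ D ∧ Disjoint D B) ∨ (B ⊆ D ∧ Disjoint D A))

/-- The point at angle `θ` on the circle with centre `c` and radius `r`. -/
noncomputable def circlePoint (c : Plane) (r θ : ℝ) : Plane :=
  c + r • !₂[Real.cos θ, Real.sin θ]

/-- The four points `x₁, x₂, x₃, x₄` are distinct and are met in this order when the circle with
centre `c` and radius `r` is traversed once counterclockwise. -/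
def InCyclicOrder (c : Plane) (r : ℝ) (x₁ x₂ x₃ x₄ : Plane) : Prop :=
  ∃ θ₁ θ₂ θ₃ θ₄ : ℝ, θ₁ < θ₂ ∧ θ₂ < θ₃ ∧ θ₃ < θ₄ ∧ θ₄ < θ₁ + 2 * Real.pi ∧
    x₁ = circlePoint c r θ₁ ∧ x₂ = circlePoint c r θ₂ ∧
    x₃ = circlePoint c r θ₃ ∧ x₄ = circlePoint c r θ₄

/-! Lift the plane to the paraboloid in homogeneous coordinates, so that circles and lines become
linear functionals. The interiors enter as disjoint nonempty open connected sets `A`, `B`; let `S`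
be the lift of `A` together with the negated lift of `B`.

If `0` is not in the convex hull of `S`, Hahn-Banach gives a functional that is `≤ 0` on the lift of
`A` and `≥ 0` on that of `B`; openness makes one inequality strict, which yields a separating disk
(`circularlySeparable_of_zero_notMem_convexHull`).

Otherwise Carathéodory writes `0` with at most five points of `S`, so one set, say `A`, contributes
at most two, `a₁` and `a₂`. The line `a₁a₂` and the circle with diameter `a₁a₂` give a map from the
plane to `ℝ²` that vanishes only at `a₁`, `a₂`, and a positive combination of at most three of its
values on `B` is zero. Connectedness reduces these to two opposite values
(`exists_antipodal_of_isPreconnected`). This means that a chord of `B` crosses `a₁a₂` at a point of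
equal power on both, and the converse of the intersecting chords theorem provides the circle.

Conversely, four alternating points on a circle satisfy a linear dependence with alternating signs,
which no separating functional tolerates. -/

/-! ### Linear functionals on the paraboloid and separating disks -/

/-- The lift of the plane to the paraboloid, in homogeneous coordinates: circles and lines of the
plane are the zero sets of the linear functionals on the ambient space. -/
def paraboloidLift (x : Plane) : Fin 4 → ℝ := ![1, x 0, x 1, x 0 ^ 2 + x 1 ^ 2]

lemma linearMap_paraboloidLift (f : (Fin 4 → ℝ) →ₗ[ℝ] ℝ) (x : Plane) :
    f (paraboloidLift x) = f (Pi.single 0 1) + f (Pi.single 1 1) * x 0 + f (Pi.single 2 1) * x 1 +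
      f (Pi.single 3 1) * (x 0 ^ 2 + x 1 ^ 2) := by
  have h : paraboloidLift x = Pi.single 0 1 + x 0 • Pi.single 1 1 + x 1 • Pi.single 2 1 +
      (x 0 ^ 2 + x 1 ^ 2) • Pi.single 3 1 := by
    ext i
    fin_cases i <;> simp [paraboloidLift]
  rw [h]
  simp only [map_add, map_smul, smul_eq_mul]
  ring

lemma CircularlySeparable.symm {A B : Set Plane} (h : CircularlySeparable A B) :
    CircularlySeparable B A := by
  obtain ⟨D, hD, h⟩ := h
  exact ⟨D, hD, h.symm⟩

lemma IsOpen.exists_add_sub_smul_mem {A : Set Plane} (hA : IsOpen A) {x : Plane} (hx : x ∈ A)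
    (w : Plane) : ∃ t : ℝ, 0 < t ∧ x + t • w ∈ A ∧ x - t • w ∈ A := by
  have h1 : ∀ᶠ t : ℝ in nhds 0, x + t • w ∈ A :=
    (by fun_prop : Continuous fun t : ℝ => x + t • w).continuousAt.eventually_mem
      (by simpa using hA.mem_nhds hx)
  have h2 : ∀ᶠ t : ℝ in nhds 0, x - t • w ∈ A :=
    (by fun_prop : Continuous fun t : ℝ => x - t • w).continuousAt.eventually_mem
      (by simpa using hA.mem_nhds hx)
  obtain ⟨e, he, h⟩ := Metric.eventually_nhds_iff.1 (h1.and h2)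
  exact ⟨e / 2, by positivity, h (by simp [abs_of_pos he, he])⟩

/-- For `α = 0` the disk is a half-plane, since a nonzero constant cannot have both signs; for `α >
0` it is a ball, by completing the square. Openness of `A` makes its inequality strict. -/
lemma circularlySeparable_of_quadratic {A B : Set Plane} (hA : IsOpen A) (hA' : A.Nonempty)
    {d u v α : ℝ} (hα : 0 ≤ α) (h0 : d ≠ 0 ∨ u ≠ 0 ∨ v ≠ 0 ∨ α ≠ 0)
    (hqA : ∀ x ∈ A, d + u * x 0 + v * x 1 + α * (x 0 ^ 2 + x 1 ^ 2) ≤ 0)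
    (hqB : ∀ x ∈ B, 0 ≤ d + u * x 0 + v * x 1 + α * (x 0 ^ 2 + x 1 ^ 2))
    (hB' : B.Nonempty) : CircularlySeparable A B := by
  rcases hα.eq_or_lt with rfl | hα
  · have huv : 0 < u ^ 2 + v ^ 2 := by
      by_contra! h
      have hu : u = 0 := by nlinarith
      have hv : v = 0 := by nlinarith
      subst hu hv
      obtain ⟨a, ha⟩ := hA'
      obtain ⟨b, hb⟩ := hB'
      have h1 := hqA a ha
      have h2 := hqB b hb
      simp only [ne_eq, not_true_eq_false, or_false] at h0
      exact h0 (by linarith)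
    refine ⟨{x | inner ℝ !₂[u, v] x < -d}, Or.inr ⟨!₂[u, v], -d, ?_, rfl⟩, Or.inl ⟨?_, ?_⟩⟩
    · intro h
      have h1 : u = 0 := by simpa using congrArg (fun x : Plane => x 0) h
      have h2 : v = 0 := by simpa using congrArg (fun x : Plane => x 1) h
      simp [h1, h2] at huv
    · intro x hx
      obtain ⟨t, ht, hxt, -⟩ := hA.exists_add_sub_smul_mem hx !₂[u, v]
      have := hqA _ hxt
      simp [PiLp.inner_apply, Fin.sum_univ_two] at this ⊢
      nlinarith [mul_pos ht huv]
    · rw [Set.disjoint_left]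
      intro x hx hxB
      have := hqB x hxB
      simp [PiLp.inner_apply, Fin.sum_univ_two] at this hx
      linarith
  · have key : ∀ x ∈ A, d + u * x 0 + v * x 1 + α * (x 0 ^ 2 + x 1 ^ 2) < 0 := by
      intro x hx
      -- The mean of the quadratic at `x ± t • e₀`, where `e₀` is the first basis vector, exceeds
      -- its value at `x` by `α * t ^ 2`.
      obtain ⟨t, ht, h1, h2⟩ := hA.exists_add_sub_smul_mem hx !₂[1, 0]
      have h1 := hqA _ h1
      have h2 := hqA _ h2
      simp at h1 h2
      nlinarith [mul_pos hα (mul_pos ht ht)]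
    set R : ℝ := (u ^ 2 + v ^ 2) / (4 * α ^ 2) - d / α with hR
    have hmem : ∀ x : Plane, d + u * x 0 + v * x 1 + α * (x 0 ^ 2 + x 1 ^ 2) =
        α * ((x 0 + u / (2 * α)) ^ 2 + (x 1 + v / (2 * α)) ^ 2 - R) := by
      intro x
      rw [hR]
      field_simp
      ring
    have hRpos : 0 < R := by
      obtain ⟨a, ha⟩ := hA'
      have := key a ha
      rw [hmem] at this
      nlinarith [neg_of_mul_neg_right this hα.le, sq_nonneg (a 0 + u / (2 * α)),
        sq_nonneg (a 1 + v / (2 * α))]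
    have hball : ∀ x : Plane, x ∈ Metric.ball (!₂[-(u / (2 * α)), -(v / (2 * α))] : Plane) (√R) ↔
        d + u * x 0 + v * x 1 + α * (x 0 ^ 2 + x 1 ^ 2) < 0 := by
      intro x
      rw [Metric.mem_ball, EuclideanSpace.dist_eq, Real.sqrt_lt_sqrt_iff (by positivity), hmem]
      simp only [Fin.sum_univ_two, Real.dist_eq, sq_abs]
      simp only [Matrix.cons_val_zero, Matrix.cons_val_one, sub_neg_eq_add]
      exact ⟨fun h => mul_neg_of_pos_of_neg hα (by linarith),
        fun h => by linarith [neg_of_mul_neg_right h hα.le]⟩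
    refine ⟨_, Or.inl ⟨_, √R, Real.sqrt_pos.2 hRpos, rfl⟩,
      Or.inl ⟨fun x hx => (hball x).2 (key x hx), ?_⟩⟩
    rw [Set.disjoint_left]
    intro x hx hxB
    exact absurd ((hball x).1 hx) (not_lt.2 (hqB x hxB))

lemma circularlySeparable_of_linearMap {A B : Set Plane} (hA : IsOpen A) (hB : IsOpen B)
    (hA' : A.Nonempty) (hB' : B.Nonempty) {f : (Fin 4 → ℝ) →ₗ[ℝ] ℝ} (hf : f ≠ 0)
    (hfA : ∀ x ∈ A, f (paraboloidLift x) ≤ 0) (hfB : ∀ x ∈ B, 0 ≤ f (paraboloidLift x)) :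
    CircularlySeparable A B := by
  have h0 : f (Pi.single 0 1) ≠ 0 ∨ f (Pi.single 1 1) ≠ 0 ∨ f (Pi.single 2 1) ≠ 0 ∨
      f (Pi.single 3 1) ≠ 0 := by
    by_contra! h
    apply hf
    apply LinearMap.pi_ext'
    intro i
    ext
    fin_cases i <;> simp [h]
  simp only [linearMap_paraboloidLift] at hfA hfB
  rcases le_total 0 (f (Pi.single 3 1)) with h | h
  · exact circularlySeparable_of_quadratic hA hA' h h0 hfA hfB hB'
  · refine (circularlySeparable_of_quadratic (A := B) (B := A) (d := -f (Pi.single 0 1))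
      (u := -f (Pi.single 1 1)) (v := -f (Pi.single 2 1)) (α := -f (Pi.single 3 1)) hB hB'
      (by linarith) (by simpa using h0) ?_ ?_ hA').symm
    · intro x hx
      linarith [hfB x hx]
    · intro x hx
      linarith [hfA x hx]

lemma circularlySeparable_of_zero_notMem_convexHull {A B : Set Plane} (hA : IsOpen A)
    (hB : IsOpen B) (hA' : A.Nonempty) (hB' : B.Nonempty)
    (h : (0 : Fin 4 → ℝ) ∉
      convexHull ℝ (paraboloidLift '' A ∪ (fun x => -paraboloidLift x) '' B)) :
    CircularlySeparable A B := by
  set S := paraboloidLift '' A ∪ (fun x => -paraboloidLift x) '' B with hS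
  have hSA : ∀ x ∈ A, paraboloidLift x ∈ S := fun x hx => Or.inl ⟨x, hx, rfl⟩
  have hSB : ∀ x ∈ B, -paraboloidLift x ∈ S := fun x hx => Or.inr ⟨x, hx, rfl⟩
  obtain ⟨a, ha⟩ := hA'
  by_cases hspan : affineSpan ℝ S = ⊤
  · obtain ⟨f, hf, hfS⟩ := geometric_hahn_banach_of_nonempty_interior_point (convex_convexHull ℝ S)
      (fun h' => h (interior_subset h'))
      (interior_convexHull_nonempty_iff_affineSpan_eq_top.2 hspan)
    refine circularlySeparable_of_linearMap hA hB ⟨a, ha⟩ hB' (f := f.toLinearMap) ?_ ?_ ?_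
    · intro h0
      exact hf (ContinuousLinearMap.coe_injective h0)
    · intro x hx
      simpa using hfS _ (subset_convexHull ℝ S (hSA x hx))
    · intro x hx
      simpa using hfS _ (subset_convexHull ℝ S (hSB x hx))
  -- The hull has empty interior here. A nonzero functional vanishing on the direction of the span
  -- is constant on `S`, hence takes opposite constant values on the two lifts.
  · have hdir : (affineSpan ℝ S).direction ≠ ⊤ := by
      rwa [Ne, AffineSubspace.direction_eq_top_iff_of_nonempty]
      exact ⟨_, subset_affineSpan ℝ S (hSA a ha)⟩
    obtain ⟨f, hf, hfS⟩ := Submodule.exists_le_ker_of_lt_top _ (lt_top_iff_ne_top.2 hdir)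
    have hconst : ∀ y ∈ S, f y = f (paraboloidLift a) := by
      intro y hy
      have : y - paraboloidLift a ∈ (affineSpan ℝ S).direction :=
        AffineSubspace.vsub_mem_direction (subset_affineSpan ℝ S hy)
          (subset_affineSpan ℝ S (hSA a ha))
      have := hfS this
      rw [LinearMap.mem_ker, map_sub] at this
      linarith
    have hcB : ∀ x ∈ B, f (paraboloidLift x) = -f (paraboloidLift a) := by
      intro x hx
      have := hconst _ (hSB x hx)
      rw [map_neg] at this
      linarith
    rcases le_total (f (paraboloidLift a)) 0 with h1 | h1
    · refine circularlySeparable_of_linearMap hA hB ⟨a, ha⟩ hB' hf ?_ ?_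
      · intro x hx
        rw [hconst _ (hSA x hx)]
        exact h1
      · intro x hx
        rw [hcB x hx]
        linarith
    · refine circularlySeparable_of_linearMap hA hB ⟨a, ha⟩ hB' (f := -f) (neg_ne_zero.2 hf) ?_ ?_
      · intro x hx
        rw [LinearMap.neg_apply, hconst _ (hSA x hx)]
        linarith
      · intro x hx
        rw [LinearMap.neg_apply, hcB x hx]
        linarith

/-! ### Topology of the interior of a polygon -/

lemma Polygon.isClosed_boundary {n : ℕ} (P : Polygon Plane n) : IsClosed (P.boundary ℝ) := by
  refine isClosed_iUnion_of_finite fun i => ?_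
  rw [Polygon.edgeSet_eq_image_edgePath]
  exact (isCompact_Icc.image (AffineMap.lineMap_continuous)).isClosed

lemma Polygon.IsInterior.isOpen {n : ℕ} {P : Polygon Plane n} {U : Set Plane}
    (h : P.IsInterior U) : IsOpen U := by
  obtain ⟨-, x, -, rfl⟩ := h
  exact P.isClosed_boundary.isOpen_compl.connectedComponentIn

lemma Polygon.IsInterior.isPreconnected {n : ℕ} {P : Polygon Plane n} {U : Set Plane}
    (h : P.IsInterior U) : IsPreconnected U := by
  obtain ⟨-, x, -, rfl⟩ := h
  exact isPreconnected_connectedComponentIn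

lemma Polygon.IsInterior.nonempty {n : ℕ} {P : Polygon Plane n} {U : Set Plane}
    (h : P.IsInterior U) : U.Nonempty := by
  obtain ⟨-, x, hx, rfl⟩ := h
  exact ⟨x, mem_connectedComponentIn hx⟩

/-! ### From a convex dependence to crossing chords -/

/-- Two chords, with endpoints in `A` and in `B` respectively, which cross in the point `z` and for
which `z` has the same power with respect to both. -/
def HasCrossingChords (A B : Set Plane) : Prop :=
  ∃ z u v : Plane, ∃ k m : ℝ, 0 < k ∧ 0 < m ∧ u ≠ 0 ∧ v ≠ 0 ∧
    z + u ∈ A ∧ z - k • u ∈ A ∧ z + v ∈ B ∧ z - m • v ∈ B ∧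
    k * (u 0 ^ 2 + u 1 ^ 2) = m * (v 0 ^ 2 + v 1 ^ 2)

lemma HasCrossingChords.symm {A B : Set Plane} (h : HasCrossingChords A B) :
    HasCrossingChords B A := by
  obtain ⟨z, u, v, k, m, hk, hm, hu, hv, h1, h2, h3, h4, h5⟩ := h
  exact ⟨z, v, u, m, k, hm, hk, hv, hu, h3, h4, h1, h2, h5.symm⟩

lemma Plane.sq_add_sq_pos {u : Plane} (hu : u ≠ 0) : 0 < u 0 ^ 2 + u 1 ^ 2 := by
  by_contra! h
  apply hu
  ext i
  fin_cases i
  · simp; nlinarith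
  · simp; nlinarith

/-- Let `pᵢ = (f bᵢ, g bᵢ)`. If no two values on `B` are opposite, none lies on the rays through
`-p₂` and `-p₃`. The open sector between these rays then cuts out a relatively clopen part of `B`,
which contains `b₁` but not `b₂`. -/
lemma exists_antipodal_of_isPreconnected {X : Type*} [TopologicalSpace X] {B : Set X}
    (hB : IsPreconnected B) {f g : X → ℝ} (hf : Continuous f) (hg : Continuous g)
    (h0 : ∀ x ∈ B, f x ≠ 0 ∨ g x ≠ 0) {b₁ b₂ b₃ : X} (h₁ : b₁ ∈ B) (h₂ : b₂ ∈ B) (h₃ : b₃ ∈ B)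
    {r₁ r₂ r₃ : ℝ} (hr₁ : 0 < r₁) (hr₂ : 0 < r₂) (hr₃ : 0 < r₃)
    (hsf : r₁ * f b₁ + r₂ * f b₂ + r₃ * f b₃ = 0) (hsg : r₁ * g b₁ + r₂ * g b₂ + r₃ * g b₃ = 0) :
    ∃ x ∈ B, ∃ y ∈ B, ∃ k : ℝ, 0 < k ∧ f x = -k * f y ∧ g x = -k * g y := by
  wlog hd : 0 ≤ f b₂ * g b₃ - g b₂ * f b₃ generalizing b₂ b₃ r₂ r₃
  · exact this h₃ h₂ hr₃ hr₂ (by linarith) (by linarith) (by linarith)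
  by_contra! hno
  have hpar : ∀ x ∈ B, ∀ y ∈ B, f x * g y - g x * f y = 0 →
      ∃ k : ℝ, 0 < k ∧ f x = k * f y ∧ g x = k * g y := by
    intro x hx y hy hxy
    have hex : ∃ k : ℝ, f x = k * f y ∧ g x = k * g y := by
      rcases h0 y hy with h | h
      · exact ⟨f x / f y, by field_simp, by field_simp; linarith⟩
      · exact ⟨g x / g y, by field_simp; linarith, by field_simp⟩
    obtain ⟨k, hk1, hk2⟩ := hex
    refine ⟨k, ?_, hk1, hk2⟩
    by_contra! hk
    rcases hk.eq_or_lt with rfl | hk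
    · rcases h0 x hx with h | h <;> simp_all
    · exact hno x hx y hy (-k) (by linarith) (by linarith) (by linarith)
  -- If `p₂` and `p₃` are parallel they point the same way, and `p₁` is opposite to both.
  rcases hd.eq_or_lt with hd | hd
  · obtain ⟨k, hk, hk1, hk2⟩ := hpar b₂ h₂ b₃ h₃ hd.symm
    refine hno b₁ h₁ b₃ h₃ ((r₂ * k + r₃) / r₁) (by positivity) ?_ ?_
    · field_simp
      rw [hk1] at hsf
      linarith
    · field_simp
      rw [hk2] at hsg
      linarith
  · have hopen : IsOpen {x | 0 < f b₃ * g x - g b₃ * f x ∧ 0 < f x * g b₂ - g x * f b₂} := by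
      apply IsOpen.and <;> exact isOpen_lt continuous_const (by fun_prop)
    have hclosed : IsClosed {x | 0 ≤ f b₃ * g x - g b₃ * f x ∧ 0 ≤ f x * g b₂ - g x * f b₂} := by
      apply IsClosed.and <;> exact isClosed_le continuous_const (by fun_prop)
    obtain ⟨x, -, hx1, hx2⟩ := hB _ _ hopen hclosed.isOpen_compl
      (by
        intro x hx
        by_contra hx'
        simp only [Set.mem_union, Set.mem_compl_iff, not_or, not_not] at hx'
        obtain ⟨hn, hc1, hc2⟩ := hx'
        rcases hc1.eq_or_lt with hc1' | hc1'
        · obtain ⟨k, hk, hk1, hk2⟩ := hpar x hx b₃ h₃ (by linarith)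
          rw [hk1, hk2] at hc2
          nlinarith
        · rcases hc2.eq_or_lt with hc2' | hc2'
          · obtain ⟨k, hk, hk1, hk2⟩ := hpar x hx b₂ h₂ (by linarith)
            rw [hk1, hk2] at hc1
            nlinarith
          · exact hn ⟨hc1', hc2'⟩)
      ⟨b₁, h₁, by
        have e1 : r₁ * (f b₃ * g b₁ - g b₃ * f b₁) = r₂ * (f b₂ * g b₃ - g b₂ * f b₃) := by
          linear_combination f b₃ * hsg - g b₃ * hsf
        have e2 : r₁ * (f b₁ * g b₂ - g b₁ * f b₂) = r₃ * (f b₂ * g b₃ - g b₂ * f b₃) := by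
          linear_combination g b₂ * hsf - f b₂ * hsg
        exact ⟨pos_of_mul_pos_right (e1 ▸ mul_pos hr₂ hd) hr₁.le,
          pos_of_mul_pos_right (e2 ▸ mul_pos hr₃ hd) hr₁.le⟩⟩
      ⟨b₂, h₂, by
        intro h
        have := h.1
        linarith⟩
    exact hx2 ⟨hx1.1.le, hx1.2.le⟩

lemma exists_eq_add_smul_of_cross_eq_zero {a₁ a₂ z : Plane} (ha : a₁ ≠ a₂)
    (h : (a₂ 0 - a₁ 0) * (z 1 - a₁ 1) - (a₂ 1 - a₁ 1) * (z 0 - a₁ 0) = 0) :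
    ∃ τ : ℝ, z = a₁ + τ • (a₂ - a₁) := by
  have hw := Plane.sq_add_sq_pos (sub_ne_zero.2 ha.symm)
  simp only [PiLp.sub_apply] at hw
  refine ⟨((z 0 - a₁ 0) * (a₂ 0 - a₁ 0) + (z 1 - a₁ 1) * (a₂ 1 - a₁ 1)) /
    ((a₂ 0 - a₁ 0) ^ 2 + (a₂ 1 - a₁ 1) ^ 2), ?_⟩
  ext i
  fin_cases i
  · simp
    field_simp
    linear_combination -(a₂ 1 - a₁ 1) * h
  · simp
    field_simp
    linear_combination (a₂ 0 - a₁ 0) * h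

lemma eq_or_eq_of_cross_eq_zero {a₁ a₂ z : Plane} (ha : a₁ ≠ a₂)
    (h : (a₂ 0 - a₁ 0) * (z 1 - a₁ 1) - (a₂ 1 - a₁ 1) * (z 0 - a₁ 0) = 0)
    (hg : (z 0 - a₁ 0) * (z 0 - a₂ 0) + (z 1 - a₁ 1) * (z 1 - a₂ 1) = 0) : z = a₁ ∨ z = a₂ := by
  obtain ⟨τ, rfl⟩ := exists_eq_add_smul_of_cross_eq_zero ha h
  have hw := Plane.sq_add_sq_pos (sub_ne_zero.2 ha.symm)
  simp at hg hw
  have : τ * (1 - τ) * ((a₂ 0 - a₁ 0) ^ 2 + (a₂ 1 - a₁ 1) ^ 2) = 0 := by linear_combination -hg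
  rcases mul_eq_zero.1 ((mul_eq_zero.1 this).resolve_right hw.ne') with h | h
  · simp [h]
  · right
    rw [← sub_eq_zero.1 h]
    simp

/-- By `hl` the weighted mean `z` of `b₁` and `b₂` lies on the line `a₁a₂`. Averaging `hg` equates
the powers of `z` on the two chords; the power is positive on the chord of `B`, so `z` lies strictly
between `a₁` and `a₂`. -/
lemma hasCrossingChords_of_antipodal {A B : Set Plane} (hAB : Disjoint A B) {a₁ a₂ b₁ b₂ : Plane}
    (ha₁ : a₁ ∈ A) (ha₂ : a₂ ∈ A) (hb₁ : b₁ ∈ B) (hb₂ : b₂ ∈ B) (ha : a₁ ≠ a₂) {k : ℝ} (hk : 0 < k)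
    (hl : (a₂ 0 - a₁ 0) * (b₁ 1 - a₁ 1) - (a₂ 1 - a₁ 1) * (b₁ 0 - a₁ 0) =
      -k * ((a₂ 0 - a₁ 0) * (b₂ 1 - a₁ 1) - (a₂ 1 - a₁ 1) * (b₂ 0 - a₁ 0)))
    (hg : (b₁ 0 - a₁ 0) * (b₁ 0 - a₂ 0) + (b₁ 1 - a₁ 1) * (b₁ 1 - a₂ 1) =
      -k * ((b₂ 0 - a₁ 0) * (b₂ 0 - a₂ 0) + (b₂ 1 - a₁ 1) * (b₂ 1 - a₂ 1))) :
    HasCrossingChords A B := by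
  have hb : b₁ ≠ b₂ := by
    rintro rfl
    rcases eq_or_eq_of_cross_eq_zero (z := b₁) ha (by nlinarith) (by nlinarith) with rfl | rfl
    · exact Set.disjoint_left.1 hAB ha₁ hb₁
    · exact Set.disjoint_left.1 hAB ha₂ hb₁
  have hk1 : 0 < 1 + k := by linarith
  obtain ⟨τ, hτ⟩ := exists_eq_add_smul_of_cross_eq_zero
    (z := (1 + k)⁻¹ • (b₁ + k • b₂)) ha (by
      simp
      field_simp
      linear_combination hl)
  have hw := Plane.sq_add_sq_pos (sub_ne_zero.2 ha.symm)
  have hv := Plane.sq_add_sq_pos (sub_ne_zero.2 hb)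
  have hτ0 := congrArg (fun x : Plane => x 0) hτ
  have hτ1 := congrArg (fun x : Plane => x 1) hτ
  simp at hw hv hτ0 hτ1
  have hpow : τ * (1 - τ) * ((a₂ 0 - a₁ 0) ^ 2 + (a₂ 1 - a₁ 1) ^ 2) =
      k / (1 + k) ^ 2 * ((b₁ 0 - b₂ 0) ^ 2 + (b₁ 1 - b₂ 1) ^ 2) := by
    have e0 : b₁ 0 = (1 + k) * (a₁ 0 + τ * (a₂ 0 - a₁ 0)) - k * b₂ 0 := by
      rw [← hτ0]
      field_simp
      ring
    have e1 : b₁ 1 = (1 + k) * (a₁ 1 + τ * (a₂ 1 - a₁ 1)) - k * b₂ 1 := by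
      rw [← hτ1]
      field_simp
      ring
    rw [e0, e1] at hg ⊢
    field_simp
    linear_combination (-1 - k) * hg
  have hττ : 0 < τ * (1 - τ) :=
    pos_of_mul_pos_left (hpow ▸ mul_pos (by positivity) hv) hw.le
  have hτpos : 0 < τ := by nlinarith
  have hτlt : τ < 1 := by nlinarith
  refine ⟨(1 + k)⁻¹ • (b₁ + k • b₂), -τ • (a₂ - a₁), (k / (1 + k)) • (b₁ - b₂), (1 - τ) / τ, 1 / k,
    div_pos (by linarith) hτpos, by positivity,
    smul_ne_zero (neg_ne_zero.2 hτpos.ne') (sub_ne_zero.2 ha.symm),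
    smul_ne_zero (by positivity) (sub_ne_zero.2 hb), ?_, ?_, ?_, ?_, ?_⟩
  · rw [hτ]
    convert ha₁ using 1
    module
  · rw [hτ, smul_smul]
    convert ha₂ using 1
    rw [show (1 - τ) / τ * -τ = τ - 1 by field_simp; ring]
    module
  · convert hb₁ using 1
    ext i
    simp
    field_simp
    ring
  · convert hb₂ using 1
    ext i
    simp
    field_simp
    ring
  · simp
    trans τ * (1 - τ) * ((a₂ 0 - a₁ 0) ^ 2 + (a₂ 1 - a₁ 1) ^ 2)
    · field_simp
    · rw [hpow]
      field_simp

/-- Splitting weights allows repeated points, so that exactly three terms can always be assumed. -/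
lemma Finset.exists_sum_eq_of_card_le_three {ι : Type*} {J : Finset ι} (hJ : J.Nonempty)
    (hcard : J.card ≤ 3) {w : ι → ℝ} (hw : ∀ i, 0 < w i) :
    ∃ j₁ ∈ J, ∃ j₂ ∈ J, ∃ j₃ ∈ J, ∃ r₁ r₂ r₃ : ℝ, 0 < r₁ ∧ 0 < r₂ ∧ 0 < r₃ ∧
      ∀ φ : ι → ℝ, ∑ j ∈ J, w j * φ j = r₁ * φ j₁ + r₂ * φ j₂ + r₃ * φ j₃ := by
  classical
  have hpos := hJ.card_pos
  obtain h | h | h : J.card = 1 ∨ J.card = 2 ∨ J.card = 3 := by omega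
  · obtain ⟨j, rfl⟩ := Finset.card_eq_one.1 h
    have := hw j
    refine ⟨j, by simp, j, by simp, j, by simp, w j / 3, w j / 3, w j / 3, by positivity,
      by positivity, by positivity, fun φ => ?_⟩
    rw [Finset.sum_singleton]
    ring
  · obtain ⟨j, k, hjk, rfl⟩ := Finset.card_eq_two.1 h
    have h1 := hw j
    have h2 := hw k
    refine ⟨j, by simp, k, by simp, k, by simp, w j, w k / 2, w k / 2, by positivity,
      by positivity, by positivity, fun φ => ?_⟩
    rw [Finset.sum_pair hjk]
    ring
  · obtain ⟨j, k, l, hjk, hjl, hkl, rfl⟩ := Finset.card_eq_three.1 h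
    refine ⟨j, by simp, k, by simp, l, by simp, w j, w k, w l, hw j, hw k, hw l, fun φ => ?_⟩
    rw [Finset.sum_insert (by simp [hjk, hjl]), Finset.sum_pair hkl]
    ring

lemma hasCrossingChords_of_sum_eq {A B : Set Plane} (hAB : Disjoint A B) (hB : IsPreconnected B)
    {ι : Type*} {I J : Finset ι} {x : ι → Plane} {w : ι → ℝ} (hw : ∀ i, 0 < w i)
    (hI : I.Nonempty) (hJ : J.Nonempty) (hIA : ∀ i ∈ I, x i ∈ A) (hJB : ∀ j ∈ J, x j ∈ B)
    (hsum : ∀ d u v α : ℝ,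
      ∑ i ∈ I, w i * (d + u * x i 0 + v * x i 1 + α * (x i 0 ^ 2 + x i 1 ^ 2)) =
      ∑ j ∈ J, w j * (d + u * x j 0 + v * x j 1 + α * (x j 0 ^ 2 + x j 1 ^ 2)))
    (hI2 : I.card ≤ 2) (hIJ : I.card + J.card ≤ 5) : HasCrossingChords A B := by
  classical
  obtain ⟨i₁, i₂, hi₁, hi₂, hII⟩ : ∃ i₁ i₂, i₁ ∈ I ∧ i₂ ∈ I ∧ ∀ i ∈ I, i = i₁ ∨ i = i₂ := by
    have := hI.card_pos
    obtain h | h : I.card = 1 ∨ I.card = 2 := by omega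
    · obtain ⟨i, rfl⟩ := Finset.card_eq_one.1 h
      exact ⟨i, i, by simp⟩
    · obtain ⟨i, k, -, rfl⟩ := Finset.card_eq_two.1 h
      exact ⟨i, k, by simp⟩
  set a₁ := x i₁ with ha₁
  set a₂ := x i₂ with ha₂
  have hsl : ∑ j ∈ J, w j *
      ((a₂ 0 - a₁ 0) * (x j 1 - a₁ 1) - (a₂ 1 - a₁ 1) * (x j 0 - a₁ 0)) = 0 := by
    -- Coefficients of the line through `a₁` and `a₂`.
    have h := hsum (a₁ 0 * a₂ 1 - a₂ 0 * a₁ 1) (a₁ 1 - a₂ 1) (a₂ 0 - a₁ 0) 0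
    rw [Finset.sum_eq_zero] at h
    · rw [h]
      exact Finset.sum_congr rfl fun j _ => by ring
    · intro i hi
      rcases hII i hi with rfl | rfl
      · rw [← ha₁]
        ring
      · rw [← ha₂]
        ring
  have hsg : ∑ j ∈ J, w j *
      ((x j 0 - a₁ 0) * (x j 0 - a₂ 0) + (x j 1 - a₁ 1) * (x j 1 - a₂ 1)) = 0 := by
    -- Coefficients of the circle with diameter `a₁a₂`.
    have h := hsum (a₁ 0 * a₂ 0 + a₁ 1 * a₂ 1) (-(a₁ 0 + a₂ 0)) (-(a₁ 1 + a₂ 1)) 1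
    rw [Finset.sum_eq_zero] at h
    · rw [h]
      exact Finset.sum_congr rfl fun j _ => by ring
    · intro i hi
      rcases hII i hi with rfl | rfl
      · rw [← ha₁]
        ring
      · rw [← ha₂]
        ring
  -- If `a₁ = a₂`, a positive combination of squared distances to `a₁` vanishes, which puts `a₁` in
  -- `B`. So `I` has two elements and `J` at most three.
  have hne : a₁ ≠ a₂ := by
    intro h
    rw [← h] at hsg
    obtain ⟨j, hj⟩ := hJ
    have hnn : ∀ j ∈ J, 0 ≤ w j *
        ((x j 0 - a₁ 0) * (x j 0 - a₁ 0) + (x j 1 - a₁ 1) * (x j 1 - a₁ 1)) := fun j _ =>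
      mul_nonneg (hw j).le (add_nonneg (mul_self_nonneg _) (mul_self_nonneg _))
    have h0 := (mul_eq_zero.1 ((Finset.sum_eq_zero_iff_of_nonneg hnn).1 hsg j hj)).resolve_left
      (hw j).ne'
    refine hAB.ne_of_mem (hIA i₁ hi₁) (hJB j hj) ?_
    rw [← ha₁]
    ext i
    fin_cases i
    · simp
      nlinarith
    · simp
      nlinarith
  have hI1 : I.card ≠ 1 := by
    intro h
    obtain ⟨i, rfl⟩ := Finset.card_eq_one.1 h
    rw [Finset.mem_singleton] at hi₁ hi₂
    exact hne (by rw [ha₁, ha₂, hi₁, hi₂])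
  have hI0 := hI.card_pos
  obtain ⟨j₁, hj₁, j₂, hj₂, j₃, hj₃, r₁, r₂, r₃, hr₁, hr₂, hr₃, hr⟩ :=
    Finset.exists_sum_eq_of_card_le_three hJ (by omega) hw
  rw [hr] at hsl hsg
  obtain ⟨b, hb, b', hb', k, hk, hl, hg⟩ := exists_antipodal_of_isPreconnected hB
    (f := fun y => (a₂ 0 - a₁ 0) * (y 1 - a₁ 1) - (a₂ 1 - a₁ 1) * (y 0 - a₁ 0))
    (g := fun y => (y 0 - a₁ 0) * (y 0 - a₂ 0) + (y 1 - a₁ 1) * (y 1 - a₂ 1))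
    (by fun_prop) (by fun_prop)
    (by
      intro y hy
      by_contra! h
      rcases eq_or_eq_of_cross_eq_zero hne h.1 h.2 with rfl | h'
      · exact hAB.ne_of_mem (hIA i₁ hi₁) hy rfl
      · exact hAB.ne_of_mem (hIA i₂ hi₂) hy h'.symm)
    (hJB j₁ hj₁) (hJB j₂ hj₂) (hJB j₃ hj₃) hr₁ hr₂ hr₃ hsl hsg
  exact hasCrossingChords_of_antipodal hAB (hIA i₁ hi₁) (hIA i₂ hi₂) hb hb' hne hk hl hg

lemma hasCrossingChords_of_zero_mem_convexHull {A B : Set Plane} (hAB : Disjoint A B)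
    (hA : IsPreconnected A) (hB : IsPreconnected B)
    (h : (0 : Fin 4 → ℝ) ∈
      convexHull ℝ (paraboloidLift '' A ∪ (fun x => -paraboloidLift x) '' B)) :
    HasCrossingChords A B := by
  classical
  obtain ⟨ι, _, z, w, hz, hind, hw, hw1, hw0⟩ := eq_pos_convex_span_of_mem_convexHull h
  have hcard : Fintype.card ι ≤ 5 := by
    refine hind.card_le_finrank_succ.trans ?_
    have := Submodule.finrank_le (vectorSpan ℝ (Set.range z))
    rw [Module.finrank_fin_fun] at this
    omega
  have hx : ∀ i, ∃ x : Plane, ∃ s : Bool, (s = true → x ∈ A ∧ z i = paraboloidLift x) ∧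
      (s = false → x ∈ B ∧ z i = -paraboloidLift x) := by
    intro i
    rcases hz ⟨i, rfl⟩ with ⟨x, hx, hxz⟩ | ⟨x, hx, hxz⟩
    · exact ⟨x, true, by simp [hx, hxz]⟩
    · exact ⟨x, false, by simp [hx, ← hxz]⟩
  choose x s hsA hsB using hx
  set I := Finset.univ.filter fun i => s i = true with hI
  set J := Finset.univ.filter fun i => ¬ s i = true with hJ
  have hIJ : I.card + J.card ≤ 5 := by
    rwa [hI, hJ, Finset.card_filter_add_card_filter_not, Finset.card_univ]
  have hIA : ∀ i ∈ I, x i ∈ A := fun i hi => (hsA i (by simpa [hI] using hi)).1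
  have hJB : ∀ j ∈ J, x j ∈ B := fun j hj => (hsB j (by simpa [hJ] using hj)).1
  have hsum : ∀ d u v α : ℝ,
      ∑ i ∈ I, w i * (d + u * x i 0 + v * x i 1 + α * (x i 0 ^ 2 + x i 1 ^ 2)) =
      ∑ j ∈ J, w j * (d + u * x j 0 + v * x j 1 + α * (x j 0 ^ 2 + x j 1 ^ 2)) := by
    intro d u v α
    have hlin : ∑ i, w i * (d * z i 0 + u * z i 1 + v * z i 2 + α * z i 3) = 0 := by
      have h0 := congrFun hw0 0
      have h1 := congrFun hw0 1
      have h2 := congrFun hw0 2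
      have h3 := congrFun hw0 3
      simp only [Finset.sum_apply, Pi.smul_apply, smul_eq_mul, Pi.zero_apply] at h0 h1 h2 h3
      simp only [mul_add, mul_left_comm (w _), Finset.sum_add_distrib, ← Finset.mul_sum, h0, h1,
        h2, h3]
      simp
    rw [← Finset.sum_filter_add_sum_filter_not Finset.univ fun i => s i = true,
      ← eq_neg_iff_add_eq_zero, ← Finset.sum_neg_distrib] at hlin
    convert hlin using 1
    · refine Finset.sum_congr rfl fun i hi => ?_
      rw [(hsA i (by simpa [hI] using hi)).2]
      simp [paraboloidLift]
    · refine Finset.sum_congr rfl fun i hi => ?_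
      rw [(hsB i (by simpa [hJ] using hi)).2]
      simp [paraboloidLift]
      ring
  have htot : ∑ i ∈ I, w i + ∑ j ∈ J, w j = 1 := by
    rw [hI, hJ, Finset.sum_filter_add_sum_filter_not, hw1]
  have heq : ∑ i ∈ I, w i = ∑ j ∈ J, w j := by simpa using hsum 1 0 0 0
  have hIne : I.Nonempty := by
    rw [Finset.nonempty_iff_ne_empty]
    intro h
    rw [← heq, h] at htot
    simp at htot
  have hJne : J.Nonempty := by
    rw [Finset.nonempty_iff_ne_empty]
    intro h
    rw [heq, h] at htot
    simp at htot
  rcases le_or_gt I.card 2 with h | h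
  · exact hasCrossingChords_of_sum_eq hAB hB hw hIne hJne hIA hJB hsum h hIJ
  · exact (hasCrossingChords_of_sum_eq hAB.symm hA hw hJne hIne hJB hIA
      (fun d u v α => (hsum d u v α).symm) (by omega) (by omega)).symm

/-! ### Cyclic order on a circle -/

/-- Twice the signed area of the triangle with vertices at the angles `a`, `b`, `c` of the unit
circle. -/
noncomputable def circleTriangleDet (a b c : ℝ) : ℝ :=
  Real.sin (b - a) + Real.sin (c - b) - Real.sin (c - a)

lemma circleTriangleDet_pos {a b c : ℝ} (hab : a < b) (hbc : b < c) (hca : c < a + 2 * Real.pi) :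
    0 < circleTriangleDet a b c := by
  have h : circleTriangleDet a b c = 4 * Real.sin ((b - a) / 2) * Real.sin ((c - b) / 2) *
      Real.sin ((c - a) / 2) := by
    obtain ⟨x, rfl⟩ : ∃ x, b = a + 2 * x := ⟨(b - a) / 2, by ring⟩
    obtain ⟨y, rfl⟩ : ∃ y, c = a + 2 * x + 2 * y := ⟨(c - (a + 2 * x)) / 2, by ring⟩
    rw [circleTriangleDet, show a + 2 * x - a = 2 * x by ring,
      show a + 2 * x + 2 * y - (a + 2 * x) = 2 * y by ring,
      show a + 2 * x + 2 * y - a = 2 * x + 2 * y by ring,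
      show (2 * x + 2 * y) / 2 = x + y by ring, mul_div_cancel_left₀ x two_ne_zero,
      mul_div_cancel_left₀ y two_ne_zero, Real.sin_add, Real.sin_add, Real.sin_two_mul,
      Real.sin_two_mul, Real.cos_two_mul, Real.cos_two_mul]
    linear_combination (-4 * Real.sin x * Real.cos x) * Real.sin_sq_add_cos_sq y -
      (4 * Real.sin y * Real.cos y) * Real.sin_sq_add_cos_sq x
  rw [h]
  have h1 : 0 < Real.sin ((b - a) / 2) := Real.sin_pos_of_pos_of_lt_pi (by linarith) (by linarith)
  have h2 : 0 < Real.sin ((c - b) / 2) := Real.sin_pos_of_pos_of_lt_pi (by linarith) (by linarith)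
  have h3 : 0 < Real.sin ((c - a) / 2) := Real.sin_pos_of_pos_of_lt_pi (by linarith) (by linarith)
  positivity

lemma circlePoint_zero (c : Plane) (r θ : ℝ) : circlePoint c r θ 0 = c 0 + r * Real.cos θ := by
  simp [circlePoint]

lemma circlePoint_one (c : Plane) (r θ : ℝ) : circlePoint c r θ 1 = c 1 + r * Real.sin θ := by
  simp [circlePoint]

lemma circlePoint_cross (p : Plane) (r a b c : ℝ) :
    (circlePoint p r c 0 - circlePoint p r a 0) * (circlePoint p r b 1 - circlePoint p r a 1) -
      (circlePoint p r c 1 - circlePoint p r a 1) * (circlePoint p r b 0 - circlePoint p r a 0) =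
      -r ^ 2 * circleTriangleDet a b c := by
  simp only [circlePoint_zero, circlePoint_one, circleTriangleDet, Real.sin_sub]
  ring

/-- A linear dependence with alternating signs between four points of a circle. -/
lemma InCyclicOrder.exists_weights {c : Plane} {r : ℝ} {x₁ x₂ x₃ x₄ : Plane}
    (h : InCyclicOrder c r x₁ x₂ x₃ x₄) :
    ∃ w₁ w₂ w₃ w₄ : ℝ, 0 < w₁ ∧ 0 < w₂ ∧ 0 < w₃ ∧ 0 < w₄ ∧ ∀ d u v α : ℝ,
      w₁ * (d + u * x₁ 0 + v * x₁ 1 + α * (x₁ 0 ^ 2 + x₁ 1 ^ 2)) +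
      w₃ * (d + u * x₃ 0 + v * x₃ 1 + α * (x₃ 0 ^ 2 + x₃ 1 ^ 2)) =
      w₂ * (d + u * x₂ 0 + v * x₂ 1 + α * (x₂ 0 ^ 2 + x₂ 1 ^ 2)) +
      w₄ * (d + u * x₄ 0 + v * x₄ 1 + α * (x₄ 0 ^ 2 + x₄ 1 ^ 2)) := by
  obtain ⟨a, b, e, f, hab, hbe, hef, hfa, rfl, rfl, rfl, rfl⟩ := h
  -- Each weight is the area of the triangle on the other three points: the affine dependence of
  -- four points in the plane. It suffices because on the circle every quadratic is affine in `(cos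
  -- θ, sin θ)`.
  refine ⟨circleTriangleDet b e f, circleTriangleDet a e f, circleTriangleDet a b f,
    circleTriangleDet a b e, circleTriangleDet_pos hbe hef (by linarith),
    circleTriangleDet_pos (by linarith) hef hfa,
    circleTriangleDet_pos hab (by linarith) hfa,
    circleTriangleDet_pos hab hbe (by linarith), ?_⟩
  intro d u v α
  have hq : ∀ θ, d + u * circlePoint c r θ 0 + v * circlePoint c r θ 1 +
      α * (circlePoint c r θ 0 ^ 2 + circlePoint c r θ 1 ^ 2) =
      (d + u * c 0 + v * c 1 + α * (c 0 ^ 2 + c 1 ^ 2 + r ^ 2)) +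
        (u * r + 2 * α * r * c 0) * Real.cos θ + (v * r + 2 * α * r * c 1) * Real.sin θ := by
    intro θ
    rw [circlePoint_zero, circlePoint_one]
    linear_combination α * r ^ 2 * Real.sin_sq_add_cos_sq θ
  simp only [hq, circleTriangleDet, Real.sin_sub]
  ring

lemma IsOpenDisk.exists_quadratic {D : Set Plane} (hD : IsOpenDisk D) :
    ∃ d u v α : ℝ, ∀ x : Plane, x ∈ D ↔ d + u * x 0 + v * x 1 + α * (x 0 ^ 2 + x 1 ^ 2) < 0 := by
  rcases hD with ⟨c, r, hr, rfl⟩ | ⟨u, b, -, rfl⟩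
  · refine ⟨c 0 ^ 2 + c 1 ^ 2 - r ^ 2, -2 * c 0, -2 * c 1, 1, fun x => ?_⟩
    rw [Metric.mem_ball, EuclideanSpace.dist_eq, Real.sqrt_lt' hr]
    simp only [Fin.sum_univ_two, Real.dist_eq, sq_abs]
    constructor <;> intro h <;> linarith
  · refine ⟨-b, u 0, u 1, 0, fun x => ?_⟩
    simp [PiLp.inner_apply, Fin.sum_univ_two]
    constructor <;> intro h <;> linarith

lemma InCyclicOrder.not_circularlySeparable {c : Plane} {r : ℝ} {x₁ x₂ x₃ x₄ : Plane}
    (h : InCyclicOrder c r x₁ x₂ x₃ x₄) {A B : Set Plane} (h₁ : x₁ ∈ A) (h₃ : x₃ ∈ A)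
    (h₂ : x₂ ∈ B) (h₄ : x₄ ∈ B) : ¬ CircularlySeparable A B := by
  rintro ⟨D, hD, hAB⟩
  obtain ⟨d, u, v, α, hD⟩ := hD.exists_quadratic
  obtain ⟨w₁, w₂, w₃, w₄, hw₁, hw₂, hw₃, hw₄, hw⟩ := h.exists_weights
  have hw := hw d u v α
  rcases hAB with ⟨hA, hB⟩ | ⟨hB, hA⟩
  · have k₁ := (hD _).1 (hA h₁)
    have k₃ := (hD _).1 (hA h₃)
    have k₂ := not_lt.1 (mt (hD _).2 (Set.disjoint_right.1 hB h₂))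
    have k₄ := not_lt.1 (mt (hD _).2 (Set.disjoint_right.1 hB h₄))
    linarith [mul_neg_of_pos_of_neg hw₁ k₁, mul_neg_of_pos_of_neg hw₃ k₃,
      mul_nonneg hw₂.le k₂, mul_nonneg hw₄.le k₄]
  · have k₂ := (hD _).1 (hB h₂)
    have k₄ := (hD _).1 (hB h₄)
    have k₁ := not_lt.1 (mt (hD _).2 (Set.disjoint_right.1 hA h₁))
    have k₃ := not_lt.1 (mt (hD _).2 (Set.disjoint_right.1 hA h₃))
    linarith [mul_neg_of_pos_of_neg hw₂ k₂, mul_neg_of_pos_of_neg hw₄ k₄,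
      mul_nonneg hw₁.le k₁, mul_nonneg hw₃.le k₃]

lemma exists_eq_circlePoint {c : Plane} {r : ℝ} (hr : 0 < r) {x : Plane}
    (hx : (x 0 - c 0) ^ 2 + (x 1 - c 1) ^ 2 = r ^ 2) (θ₀ : ℝ) :
    ∃ θ, θ₀ ≤ θ ∧ θ < θ₀ + 2 * Real.pi ∧ x = circlePoint c r θ := by
  set w : ℂ := ⟨x 0 - c 0, x 1 - c 1⟩ with hw
  have hn : ‖w‖ = r := by
    rw [← sq_eq_sq₀ (norm_nonneg _) hr.le, Complex.sq_norm, Complex.normSq_apply, ← hx]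
    simp only [hw]
    ring
  have hc : r * Real.cos w.arg = x 0 - c 0 := by rw [← hn, Complex.norm_mul_cos_arg]
  have hs : r * Real.sin w.arg = x 1 - c 1 := by rw [← hn, Complex.norm_mul_sin_arg]
  refine ⟨toIcoMod Real.two_pi_pos θ₀ w.arg, (toIcoMod_mem_Ico _ _ _).1,
    (toIcoMod_mem_Ico _ _ _).2, ?_⟩
  have hc' : Real.cos (toIcoMod Real.two_pi_pos θ₀ w.arg) = Real.cos w.arg := by
    rw [toIcoMod, zsmul_eq_mul, Real.cos_sub_int_mul_two_pi]
  have hs' : Real.sin (toIcoMod Real.two_pi_pos θ₀ w.arg) = Real.sin w.arg := by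
    rw [toIcoMod, zsmul_eq_mul, Real.sin_sub_int_mul_two_pi]
  ext i
  fin_cases i
  · simp [circlePoint_zero, hc', hc]
  · simp [circlePoint_one, hs', hs]

/-- The hypothesis `h` puts `x₂` and `x₄` on opposite sides of the line `x₁x₃`. With angles measured
from that of `x₁`, exactly one of them then precedes `x₃`. -/
lemma inCyclicOrder_of_cross {c : Plane} {r : ℝ} (hr : 0 < r) {x₁ x₂ x₃ x₄ : Plane}
    (h₁ : (x₁ 0 - c 0) ^ 2 + (x₁ 1 - c 1) ^ 2 = r ^ 2)
    (h₂ : (x₂ 0 - c 0) ^ 2 + (x₂ 1 - c 1) ^ 2 = r ^ 2)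
    (h₃ : (x₃ 0 - c 0) ^ 2 + (x₃ 1 - c 1) ^ 2 = r ^ 2)
    (h₄ : (x₄ 0 - c 0) ^ 2 + (x₄ 1 - c 1) ^ 2 = r ^ 2)
    (h : ((x₃ 0 - x₁ 0) * (x₂ 1 - x₁ 1) - (x₃ 1 - x₁ 1) * (x₂ 0 - x₁ 0)) *
      ((x₃ 0 - x₁ 0) * (x₄ 1 - x₁ 1) - (x₃ 1 - x₁ 1) * (x₄ 0 - x₁ 0)) < 0) :
    InCyclicOrder c r x₁ x₂ x₃ x₄ ∨ InCyclicOrder c r x₁ x₄ x₃ x₂ := by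
  obtain ⟨a, -, -, rfl⟩ := exists_eq_circlePoint hr h₁ 0
  obtain ⟨b, hab, hba, rfl⟩ := exists_eq_circlePoint hr h₂ a
  obtain ⟨e, hae, hea, rfl⟩ := exists_eq_circlePoint hr h₃ a
  obtain ⟨f, haf, hfa, rfl⟩ := exists_eq_circlePoint hr h₄ a
  rw [circlePoint_cross, circlePoint_cross] at h
  have hr2 : 0 < r ^ 2 * r ^ 2 := by positivity
  have h : circleTriangleDet a b e * circleTriangleDet a f e < 0 := by
    refine neg_of_mul_neg_right (a := r ^ 2 * r ^ 2) ?_ hr2.le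
    linarith
  have hsymm : ∀ t, circleTriangleDet a t e = -circleTriangleDet a e t := by
    intro t
    simp only [circleTriangleDet, Real.sin_sub]
    ring
  have hb : a ≠ b := by
    rintro rfl
    simp [circleTriangleDet] at h
  have he : a ≠ e := by
    rintro rfl
    simp [circleTriangleDet, Real.sin_sub] at h
    nlinarith
  have hf : a ≠ f := by
    rintro rfl
    simp [circleTriangleDet] at h
  have hbe : b ≠ e := by
    rintro rfl
    simp [circleTriangleDet] at h
  have hfe : f ≠ e := by
    rintro rfl
    simp [circleTriangleDet] at h
  have hab := hab.lt_of_ne hb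
  have hae := hae.lt_of_ne he
  have haf := haf.lt_of_ne hf
  rcases hbe.lt_or_gt with hbe | hbe <;> rcases hfe.lt_or_gt with hfe | hfe
  · exact absurd h (mul_pos (circleTriangleDet_pos hab hbe hea)
      (circleTriangleDet_pos haf hfe hea)).le.not_gt
  · exact Or.inl ⟨a, b, e, f, hab, hbe, hfe, hfa, rfl, rfl, rfl, rfl⟩
  · exact Or.inr ⟨a, f, e, b, haf, hfe, hbe, hba, rfl, rfl, rfl, rfl⟩
  · rw [hsymm, hsymm, neg_mul_neg] at h
    exact absurd h (mul_pos (circleTriangleDet_pos hae hbe hba)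
      (circleTriangleDet_pos hae hfe hfa)).le.not_gt

/-! ### From crossing chords to a circle -/

/-- Rotating one of two crossing chords about the crossing point makes them transverse. -/
lemma HasCrossingChords.exists_cross_ne_zero {A B : Set Plane} (hB : IsOpen B)
    (h : HasCrossingChords A B) :
    ∃ z u v : Plane, ∃ k m : ℝ, 0 < k ∧ 0 < m ∧ u 0 * v 1 - u 1 * v 0 ≠ 0 ∧
      z + u ∈ A ∧ z - k • u ∈ A ∧ z + v ∈ B ∧ z - m • v ∈ B ∧
      k * (u 0 ^ 2 + u 1 ^ 2) = m * (v 0 ^ 2 + v 1 ^ 2) := by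
  obtain ⟨z, u, v, k, m, hk, hm, hu, hv, h1, h2, h3, h4, h5⟩ := h
  by_cases hc : u 0 * v 1 - u 1 * v 0 = 0
  swap
  · exact ⟨z, u, v, k, m, hk, hm, hc, h1, h2, h3, h4, h5⟩
  have hd : u 0 * v 0 + u 1 * v 1 ≠ 0 := by
    intro hd
    have hpos := mul_pos (Plane.sq_add_sq_pos hu) (Plane.sq_add_sq_pos hv)
    have : (u 0 ^ 2 + u 1 ^ 2) * (v 0 ^ 2 + v 1 ^ 2) = 0 := by
      linear_combination (u 0 * v 0 + u 1 * v 1) * hd + (u 0 * v 1 - u 1 * v 0) * hc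
    linarith
  set R : ℝ → Plane := fun e => !₂[Real.cos e * v 0 - Real.sin e * v 1,
    Real.sin e * v 0 + Real.cos e * v 1] with hR
  have hRc : Continuous R := by
    rw [hR]
    fun_prop
  have hR0 : R 0 = v := by
    ext i
    fin_cases i <;> simp [hR]
  have e1 : ∀ᶠ e in nhds (0 : ℝ), z + R e ∈ B :=
    (by fun_prop : Continuous fun e => z + R e).continuousAt.eventually_mem
      (hB.mem_nhds (by simpa [hR0] using h3))
  have e2 : ∀ᶠ e in nhds (0 : ℝ), z - m • R e ∈ B :=
    (by fun_prop : Continuous fun e => z - m • R e).continuousAt.eventually_mem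
      (hB.mem_nhds (by simpa [hR0] using h4))
  obtain ⟨ε, hε, he⟩ := Metric.eventually_nhds_iff.1 (e1.and e2)
  -- The bound `1` keeps the angle below `π`, so that its sine is positive.
  set e := min (ε / 2) 1 with hedef
  have hepos : 0 < e := by positivity
  have hsin : 0 < Real.sin e :=
    Real.sin_pos_of_pos_of_lt_pi hepos
      (lt_of_le_of_lt (min_le_right _ _) (by linarith [Real.pi_gt_three]))
  obtain ⟨k1, k2⟩ := he (y := e) (by
    rw [Real.dist_eq, sub_zero, abs_of_pos hepos]
    exact lt_of_le_of_lt (min_le_left _ _) (by linarith))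
  refine ⟨z, u, R e, k, m, hk, hm, ?_, h1, h2, k1, k2, ?_⟩
  · have : u 0 * R e 1 - u 1 * R e 0 = Real.sin e * (u 0 * v 0 + u 1 * v 1) := by
      simp [hR]
      linear_combination Real.cos e * hc
    rw [this]
    exact mul_ne_zero hsin.ne' hd
  · rw [h5]
    simp [hR]
    left
    linear_combination (-v 0 ^ 2 - v 1 ^ 2) * Real.sin_sq_add_cos_sq e

/-- Converse of the intersecting chords theorem. The centre `z + y` is the meeting point of the
perpendicular bisectors of the transverse chords, which gives the equations for `y`. The squared
radius is `|y|²` plus the power, and equal powers make it the same for both chords. -/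
lemma HasCrossingChords.exists_inCyclicOrder {A B : Set Plane} (hB : IsOpen B)
    (h : HasCrossingChords A B) :
    ∃ (c : Plane) (r : ℝ), 0 < r ∧ ∃ x₁ x₂ x₃ x₄ : Plane, InCyclicOrder c r x₁ x₂ x₃ x₄ ∧
      x₁ ∈ B ∧ x₃ ∈ B ∧ x₂ ∈ A ∧ x₄ ∈ A := by
  obtain ⟨z, u, v, k, m, hk, hm, huv, h1, h2, h3, h4, h5⟩ := h.exists_cross_ne_zero hB
  have hu : 0 < u 0 ^ 2 + u 1 ^ 2 := by
    refine Plane.sq_add_sq_pos ?_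
    rintro rfl
    simp at huv
  set p : ℝ := (1 - k) * (u 0 ^ 2 + u 1 ^ 2) / 2 with hp
  set q : ℝ := (1 - m) * (v 0 ^ 2 + v 1 ^ 2) / 2 with hq
  set D : ℝ := u 0 * v 1 - u 1 * v 0 with hD
  obtain ⟨y₀, y₁, hyu, hyv⟩ : ∃ y₀ y₁ : ℝ, y₀ * u 0 + y₁ * u 1 = p ∧ y₀ * v 0 + y₁ * v 1 = q := by
    refine ⟨(p * v 1 - q * u 1) / D, (q * u 0 - p * v 0) / D, ?_, ?_⟩
    · field_simp
      rw [hD]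
      ring
    · field_simp
      rw [hD]
      ring
  have hr : 0 < y₀ ^ 2 + y₁ ^ 2 + k * (u 0 ^ 2 + u 1 ^ 2) := by positivity
  have hr2 := Real.sq_sqrt hr.le
  have key := inCyclicOrder_of_cross (c := !₂[z 0 + y₀, z 1 + y₁]) (Real.sqrt_pos.2 hr)
    (x₁ := z + v) (x₂ := z + u) (x₃ := z - m • v) (x₄ := z - k • u)
    (by simp [hr2]; linear_combination (-2) * hyv - h5)
    (by simp [hr2]; linear_combination (-2) * hyu)
    (by simp [hr2]; linear_combination (2 * m) * hyv - h5)
    (by simp [hr2]; linear_combination (2 * k) * hyu)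
    (by
      have : 0 < k * ((1 + m) * D) ^ 2 := by positivity
      simp only [PiLp.add_apply, PiLp.sub_apply, PiLp.smul_apply, smul_eq_mul]
      rw [hD] at this
      linarith)
  rcases key with key | key
  · exact ⟨_, _, Real.sqrt_pos.2 hr, _, _, _, _, key, h3, h4, h1, h2⟩
  · exact ⟨_, _, Real.sqrt_pos.2 hr, _, _, _, _, key, h3, h4, h2, h1⟩

theorem lemma2 {m n : ℕ} (P : Polygon Plane m) (Q : Polygon Plane n)
    (hP : P.IsSimple) (hQ : Q.IsSimple)
    (intP intQ : Set Plane) (hintP : P.IsInterior intP) (hintQ : Q.IsInterior intQ)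
    (hdisj : Disjoint intP intQ) :
    ¬ CircularlySeparable intP intQ ↔
      ∃ (c : Plane) (r : ℝ), 0 < r ∧ ∃ x₁ x₂ x₃ x₄ : Plane,
        InCyclicOrder c r x₁ x₂ x₃ x₄ ∧
        x₁ ∈ intQ ∧ x₃ ∈ intQ ∧ x₂ ∈ intP ∧ x₄ ∈ intP := by
  constructor
  · intro h
    refine HasCrossingChords.exists_inCyclicOrder hintQ.isOpen
      (hasCrossingChords_of_zero_mem_convexHull hdisj hintP.isPreconnected
        hintQ.isPreconnected ?_)
    by_contra h0
    exact h (circularlySeparable_of_zero_notMem_convexHull hintP.isOpen hintQ.isOpen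
      hintP.nonempty hintQ.nonempty h0)
  · rintro ⟨c, r, -, x₁, x₂, x₃, x₄, hx, h₁, h₃, h₂, h₄⟩ h
    exact hx.not_circularlySeparable h₁ h₃ h₂ h₄ h.symm
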